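/- Let $\mathscr{A}(\mathbb{R})$ be the space of complex-valued real analytic functions on $\mathbb{R}$ with its natural locally convex inductive limit topology $\mathscr{A}(\mathbb{R})=\operatorname{ind}_{U\supset\mathbb{R}}H(U)$, where $U$ runs over all open subsets of $\mathbb{C}$ containing $\mathbb{R}$ and $H(U)$ is the space of holomorphic functions on $U$ with the compact-open topology. A \emph{multiplier} is a continuous linear operator $M$ on $\mathscr{A}(\mathbb{R})$ such that for every $n\in\mathbb{N}=\{0,1,2,\dots\}$ there is $m_n\in\mathbb{C}$ with $M(x^n)=m_nx^n$. A $C_0$-\emph{semigroup} on $\mathscr{A}(\mathbb{R})$ is a family $(T_t)_{t\ge 0}$ of continuous linear operators with $T_{t+s}=T_tT_s$ for all $t,s\ge 0$, $T_0=I$, and $\lim_{t\to s}T_tf=T_sf$ for all $s\ge 0$ and $f\in\mathscr{A}(\mathbb{R})$. A multiplier $M$ \emph{generates} $(T_t)_{t\ge0}$ if the generator of $(T_t)_{t\ge 0}$ has domain $\mathscr{A}(\mathbb{R})$ and equals $M$, i.e. $\lim_{t\searrow 0}\frac{T_tf-f}{t}=Mf$ for every $f\in\mathscr{A}(\mathbb{R})$.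 The set of multipliers that generate a $C_0$-semigroup on $\mathscr{A}(\mathbb{R})$ is closed under addition. Moreover, if the multipliers $A$ and $B$ generate the $C_0$-semigroups $(T^A_t)_{t\ge0}$ and $(T^B_t)_{t\ge0}$, respectively, then $(T^A_tT^B_t)_{t\ge 0}$ is a $C_0$-semigroup generated by $A+B$, and it is the only $C_0$-semigroup generated by $A+B$. -/

import Mathlib

open Topology Filter TopologicalSpace
open scoped NNReal

noncomputable section

/-- The complex vector space of real analytic functions `ℝ → ℂ`, as a subspace of all functions. -/
def realAnalyticSubmodule : Submodule ℂ (ℝ → ℂ) where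
  carrier := {f | AnalyticOnNhd ℝ f Set.univ}
  add_mem' hf hg := hf.add hg
  zero_mem' := analyticOnNhd_const
  smul_mem' c _ hf := (analyticOnNhd_const (v := c)).mul hf

/-- The space `𝒜(ℝ)` of complex valued real analytic functions on `ℝ`. This is a type synonym, so
that it does not inherit the topology of pointwise convergence. -/
def RealAnalyticSpace : Type := realAnalyticSubmodule

/-- `H(U)`: the holomorphic functions on the open set `U ⊆ ℂ`, with the compact-open topology
(inherited from `C(U, ℂ)`). -/
def HolomorphicSpace (U : Opens ℂ) : Submodule ℂ C(U, ℂ) where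
  carrier := {f | ∃ g : ℂ → ℂ, DifferentiableOn ℂ g U ∧ ∀ z : U, g z = f z}
  add_mem' := by
    rintro a b ⟨g, hg, hga⟩ ⟨h, hh, hhb⟩
    exact ⟨g + h, hg.add hh, fun z => by simp [hga, hhb]⟩
  zero_mem' := ⟨0, differentiableOn_const 0, fun z => by simp⟩
  smul_mem' := by
    rintro c a ⟨g, hg, hga⟩
    exact ⟨c • g, hg.const_smul c, fun z => by simp [hga]⟩

namespace RealAnalyticSpace

instance : AddCommGroup RealAnalyticSpace := inferInstanceAs (AddCommGroup realAnalyticSubmodule)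
instance : Module ℂ RealAnalyticSpace := inferInstanceAs (Module ℂ realAnalyticSubmodule)
instance : Module ℝ RealAnalyticSpace := Module.restrictScalars ℝ ℂ RealAnalyticSpace
instance : IsScalarTower ℝ ℂ RealAnalyticSpace := IsScalarTower.restrictScalars ℝ ℂ _

instance : CoeFun RealAnalyticSpace (fun _ => ℝ → ℂ) := ⟨Subtype.val⟩

/-- `U` is a complex neighbourhood of the real line. -/
def ContainsReals (U : Opens ℂ) : Prop := ∀ x : ℝ, (x : ℂ) ∈ U

/-- The restriction map `H(U) → 𝒜(ℝ)`, for an open `U ⊇ ℝ`. -/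
def restrict (U : Opens ℂ) (hU : ContainsReals U) : HolomorphicSpace U → RealAnalyticSpace :=
  fun f => ⟨fun x => f.1 ⟨x, hU x⟩, by
    obtain ⟨g, hg, hgf⟩ := f.2
    intro x _
    have h1 : AnalyticAt ℂ g (x : ℂ) := hg.analyticAt (U.isOpen.mem_nhds (hU x))
    have h2 : AnalyticAt ℝ (fun y : ℝ => g (y : ℂ)) x :=
      AnalyticAt.fun_comp (f := fun y : ℝ => (y : ℂ)) h1.restrictScalars
        (Complex.ofRealCLM.analyticAt x)
    have h3 : (fun y : ℝ => g (y : ℂ)) = fun y : ℝ => f.1 ⟨y, hU y⟩ :=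
      funext fun y => hgf ⟨y, hU y⟩
    rwa [h3] at h2⟩

/-- The final topology on `𝒜(ℝ)` with respect to all restriction maps `H(U) → 𝒜(ℝ)`, i.e. the
inductive limit topology in the category of topological spaces (not necessarily linear). -/
@[reducible]
def finalTopology : TopologicalSpace RealAnalyticSpace :=
  ⨆ (U : Opens ℂ) (hU : ContainsReals U), coinduced (restrict U hU) inferInstance

/-- The natural topology of `𝒜(ℝ) = ind H(U)`: the inductive limit in the category of locally convex
spaces, i.e. the finest locally convex vector space topology for which all the restriction maps
`H(U) → 𝒜(ℝ)`, `U ⊇ ℝ` open, are continuous. (In Mathlib, `s ≤ t` means that `s` is finer.) -/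
instance : TopologicalSpace RealAnalyticSpace :=
  sInf {t : TopologicalSpace RealAnalyticSpace | finalTopology ≤ t ∧
    @IsTopologicalAddGroup RealAnalyticSpace t _ ∧
    @ContinuousSMul ℂ RealAnalyticSpace _ _ t ∧
    @LocallyConvexSpace ℝ RealAnalyticSpace _ _ _ _ t}

instance : IsTopologicalAddGroup RealAnalyticSpace :=
  topologicalAddGroup_sInf fun _ ⟨_, ht, _, _⟩ ↦ ht

instance : ContinuousSMul ℂ RealAnalyticSpace :=
  continuousSMul_sInf fun _ ⟨_, _, ht, _⟩ ↦ ht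

instance : LocallyConvexSpace ℝ RealAnalyticSpace :=
  .sInf fun _ ⟨_, _, _, ht⟩ ↦ ht

theorem continuous_restrict (U : Opens ℂ) (hU : ContainsReals U) :
    Continuous (restrict U hU) := by
  rw [continuous_iff_coinduced_le]
  exact le_trans (le_iSup₂_of_le U hU le_rfl) (le_sInf fun _ ht => ht.1)

theorem continuous_eval (x : ℝ) : Continuous (fun f : RealAnalyticSpace => f x) := by
  let e : RealAnalyticSpace →ₗ[ℂ] ℂ :=
    { toFun := fun f => f x, map_add' := fun _ _ => rfl, map_smul' := fun _ _ => rfl }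
  refine continuous_iff_le_induced.2 (sInf_le ⟨?_, ?_, ?_, ?_⟩)
  · refine iSup₂_le fun U hU => ?_
    rw [← continuous_iff_coinduced_le, continuous_induced_rng]
    exact (ContinuousEvalConst.continuous_eval_const (⟨x, hU x⟩ : U)).comp continuous_subtype_val
  · exact topologicalAddGroup_induced e
  · exact continuousSMul_induced e
  · exact LocallyConvexSpace.induced (e.restrictScalars ℝ)

/-- `𝒜(ℝ)` is Hausdorff, so that limits in it are unique. -/
instance : T2Space RealAnalyticSpace := by
  refine T2Space.of_injective_continuous (f := fun f : RealAnalyticSpace => (f : ℝ → ℂ))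
    Subtype.val_injective (continuous_pi continuous_eval)

/-- The monomial `x ↦ x ^ n` as an element of `𝒜(ℝ)`. -/
def monomial (n : ℕ) : RealAnalyticSpace :=
  ⟨fun x => (x : ℂ) ^ n, fun x _ => (Complex.ofRealCLM.analyticAt x).pow n⟩

/-- A multiplier: a continuous linear operator on `𝒜(ℝ)` such that every monomial is an
eigenvector. -/
def IsMultiplier (M : RealAnalyticSpace →L[ℂ] RealAnalyticSpace) : Prop :=
  ∃ m : ℕ → ℂ, ∀ n, M (monomial n) = m n • monomial n

end RealAnalyticSpace

section Semigroups

variable {X : Type*} [AddCommGroup X] [Module ℂ X] [TopologicalSpace X]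

/-- A `C₀`-semigroup `(T_t)_{t ≥ 0}` of continuous linear operators on `X`. -/
structure IsC0Semigroup (T : ℝ≥0 → X →L[ℂ] X) : Prop where
  map_add : ∀ t s, T (t + s) = T t ∘L T s
  map_zero : T 0 = ContinuousLinearMap.id ℂ X
  strongly_continuous : ∀ x, Continuous fun t => T t x

/-- The graph of the generator of `T`: the pairs `(x, y)` with
`y = lim_{t → 0} (T_t x - x) / t`. -/
def generatorGraph (T : ℝ≥0 → X →L[ℂ] X) : Set (X × X) :=
  {p | Tendsto (fun t : ℝ≥0 => (((t : ℝ) : ℂ))⁻¹ • (T t p.1 - p.1)) (𝓝[>] 0) (𝓝 p.2)}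

/-- The everywhere defined operator `M` generates the `C₀`-semigroup `T`: the generator of `T` is
`M`, with the whole space as its domain. -/
def Generates (M : X →L[ℂ] X) (T : ℝ≥0 → X →L[ℂ] X) : Prop :=
  IsC0Semigroup T ∧ generatorGraph T = {p | p.2 = M p.1}

end Semigroups

/-- The set of all multipliers on `𝒜(ℝ)` that generate a `C₀`-semigroup. -/
def generatingMultipliers : Set (RealAnalyticSpace →L[ℂ] RealAnalyticSpace) :=
  {M | RealAnalyticSpace.IsMultiplier M ∧ ∃ T, Generates M T}

end

/-! Monomials are eigenvectors of a multiplier, so along a generated semigroup the orbit of `x ^ n`,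
tested against a functional, solves a scalar linear ODE: `T t` multiplies `x ^ n` by `exp (m n *
t)`. Polynomials are dense in `𝒜(ℝ)` (`dense_span_monomial`: extend to a star-shaped neighbourhood
of `ℝ`, then apply Runge), so these eigenvalues determine `T t`. Hence the two semigroups commute,
and a multiplier generates at most one semigroup.

Commutation gives the semigroup law of the product. Its strong continuity and its generator require
passing to the limit in `S t (g t)` with both `t` and `g t` varying. As a locally convex inductive
limit of Fréchet spaces `H(U)`, `𝒜(ℝ)` is barrelled, and Banach–Steinhaus makes `S t` equicontinuous
for `t` in compact intervals (`tendsto_apply_of_isVonNBounded`). -/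

noncomputable section

/-! ### Barrelledness of `𝒜(ℝ)` and Banach–Steinhaus -/

namespace RealAnalyticSpace

/-- The restriction map `H(U) → 𝒜(ℝ)` as a linear map. -/
def restrictₗ (U : Opens ℂ) (hU : ContainsReals U) : HolomorphicSpace U →ₗ[ℂ] RealAnalyticSpace where
  toFun := restrict U hU
  map_add' _ _ := rfl
  map_smul' _ _ := rfl

/-- On the locally compact `U`, compact-open convergence is locally uniform convergence, which
preserves holomorphy (Weierstrass). -/
theorem isClosed_holomorphicSpace (U : Opens ℂ) :
    IsClosed (HolomorphicSpace U : Set C(U, ℂ)) := by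
  classical
  let e : C(U, ℂ) → ℂ → ℂ := fun f z => if h : z ∈ U then f ⟨z, h⟩ else 0
  have he : ∀ f ∈ HolomorphicSpace U, DifferentiableOn ℂ (e f) U := by
    rintro f ⟨g, hg, hgf⟩
    refine hg.congr fun z hz => ?_
    simp only [e]
    rw [dif_pos (show z ∈ U from hz), ← hgf]
  have : LocallyCompactSpace U := U.isOpen.locallyCompactSpace
  refine isClosed_of_closure_subset fun f hf => ?_
  rw [mem_closure_iff_clusterPt] at hf
  have : NeBot (𝓝 f ⊓ 𝓟 (HolomorphicSpace U : Set C(U, ℂ))) := hf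
  refine ⟨e f, ?_, fun z => by simp [e]⟩
  refine TendstoLocallyUniformlyOn.differentiableOn (F := e)
    (φ := 𝓝 f ⊓ 𝓟 (HolomorphicSpace U : Set C(U, ℂ))) ?_ ?_ U.isOpen
  · have h1 : TendstoLocallyUniformly (fun (g : C(U, ℂ)) a => g a) f
        (𝓝 f ⊓ 𝓟 (HolomorphicSpace U : Set C(U, ℂ))) :=
      ContinuousMap.tendsto_iff_tendstoLocallyUniformly.1 inf_le_left
    rw [tendstoLocallyUniformlyOn_iff_tendstoLocallyUniformly_comp_coe]
    have h2 : ∀ g : C(U, ℂ), (e g ∘ ((↑) : U → ℂ)) = g := fun g => by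
      ext z; simp [e]
    have h3 : (fun (g : C(U, ℂ)) (x : U) => e g x) = fun g a => g a := funext h2
    have h4 : (fun x : U => e f x) = f := h2 f
    have h5 : TendstoLocallyUniformly (fun (g : C(U, ℂ)) (x : U) => e g x) (fun x : U => e f x)
        (𝓝 f ⊓ 𝓟 (HolomorphicSpace U : Set C(U, ℂ))) := by rwa [h3, h4]
    exact h5
  · filter_upwards [mem_inf_of_right (mem_principal_self _)] with g hg using he g hg

/-- Complete with a countably generated uniformity, hence Baire, hence barrelled. -/
instance (U : Opens ℂ) : BarrelledSpace ℂ (HolomorphicSpace U) := by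
  have : LocallyCompactSpace U := U.isOpen.locallyCompactSpace
  have : CompleteSpace (HolomorphicSpace U) := (isClosed_holomorphicSpace U).completeSpace_coe
  have : (uniformity (HolomorphicSpace U)).IsCountablyGenerated :=
    comap.isCountablyGenerated _ _
  infer_instance

/-- A seminorm on `𝒜(ℝ)` is continuous if its pullbacks to all the spaces `H(U)` are. -/
theorem continuous_seminorm (p : Seminorm ℂ RealAnalyticSpace)
    (hp : ∀ (U : Opens ℂ) (hU : ContainsReals U), Continuous fun f => p (restrict U hU f)) :
    Continuous p := by
  let N : SeminormedAddCommGroup RealAnalyticSpace := p.toAddGroupSeminorm.toSeminormedAddCommGroup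
  let t : TopologicalSpace RealAnalyticSpace := N.toPseudoMetricSpace.toUniformSpace.toTopologicalSpace
  let S : NormedSpace ℂ RealAnalyticSpace := ⟨fun a b => (map_smul_eq_mul p a b).le⟩
  let S' : NormedSpace ℝ RealAnalyticSpace := NormedSpace.restrictScalars ℝ ℂ RealAnalyticSpace
  -- The topology of the single seminorm `p` is one of those over which the infimum is taken.
  have hle : (instTopologicalSpace : TopologicalSpace RealAnalyticSpace) ≤ t := by
    refine sInf_le ⟨?_, ?_, ?_, ?_⟩
    · refine iSup₂_le fun U hU => ?_
      rw [← continuous_iff_coinduced_le]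
      refine continuous_of_continuousAt_zero (restrictₗ U hU) ?_
      have h := (hp U hU).tendsto 0
      rw [show restrict U hU 0 = 0 from map_zero (restrictₗ U hU), map_zero] at h
      rw [ContinuousAt, map_zero]
      exact tendsto_zero_iff_norm_tendsto_zero.2 h
    · exact SeminormedAddCommGroup.toIsTopologicalAddGroup
    · exact (inferInstance : @ContinuousSMul ℂ RealAnalyticSpace _ _ t)
    · exact (NormedSpace.toLocallyConvexSpace : @LocallyConvexSpace ℝ RealAnalyticSpace _ _ _ _ t)
  have hc : @Continuous _ _ t _ p := continuous_norm
  exact continuous_le_dom hle hc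

/-- A lower semicontinuous seminorm pulls back to one on each barrelled `H(U)`, where it is
continuous. -/
instance : BarrelledSpace ℂ RealAnalyticSpace where
  continuous_of_lowerSemicontinuous p hp := continuous_seminorm p fun U hU => by
    let q : Seminorm ℂ (HolomorphicSpace U) := p.comp (restrictₗ U hU)
    exact q.continuous_of_lowerSemicontinuous (hp.comp (continuous_restrict U hU))

-- Nonnegative complex scalars are real, so convexity over `ℂ` and over `ℝ` agree; local convexity
-- then provides the seminorms for Banach–Steinhaus.
open scoped ComplexOrder in
instance : PolynormableSpace ℂ RealAnalyticSpace := by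
  have : ContinuousSMul ℝ RealAnalyticSpace := IsScalarTower.continuousSMul ℂ
  have : LocallyConvexSpace ℂ RealAnalyticSpace :=
    ⟨fun x => (LocallyConvexSpace.convex_basis (𝕜 := ℝ) x).to_hasBasis
      (fun s hs => ⟨s, ⟨hs.1, convex_of_nonneg_surjective_algebraMap _
        (fun _ hz => RCLike.nonneg_iff_exists_ofReal.mp hz) hs.2⟩, subset_rfl⟩)
      fun s hs => ⟨s, ⟨hs.1, hs.2.lift ℝ⟩, subset_rfl⟩⟩
  infer_instance

end RealAnalyticSpace

/-- In a barrelled locally convex space, a pointwise bounded family of operators may be applied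
along a convergent family of vectors. -/
theorem tendsto_apply_of_isVonNBounded {X ι α : Type*} [AddCommGroup X] [Module ℂ X]
    [TopologicalSpace X] [IsTopologicalAddGroup X] [ContinuousSMul ℂ X] [PolynormableSpace ℂ X]
    [BarrelledSpace ℂ X] {T : ι → X →L[ℂ] X}
    (hT : ∀ x, Bornology.IsVonNBounded ℂ (Set.range fun i => T i x)) {l : Filter α}
    {i : α → ι} {g : α → X} {x y : X} (hg : Tendsto g l (𝓝 x))
    (hy : Tendsto (fun a => T (i a) x) l (𝓝 y)) : Tendsto (fun a => T (i a) (g a)) l (𝓝 y) := by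
  let u : UniformSpace X := IsTopologicalAddGroup.rightUniformSpace X
  have : IsUniformAddGroup X := isUniformAddGroup_of_addCommGroup
  have h := (PolynormableSpace.banach_steinhaus hT).equicontinuous 0
  have h0 : Tendsto (fun a => T (i a) (g a - x)) l (𝓝 0) := by
    have hgx : Tendsto (fun a => g a - x) l (𝓝 0) := by simpa using hg.sub_const x
    intro V hV
    have := h {q : X × X | q.2 - q.1 ∈ V} (by
      rw [uniformity_eq_comap_nhds_zero]
      exact preimage_mem_comap hV)
    change ∀ᶠ a in l, T (i a) (g a - x) ∈ V
    filter_upwards [hgx.eventually this] with a ha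
    simpa using ha (i a)
  simpa using h0.add hy

end

/-! ### Runge approximation and holomorphic extension -/

noncomputable section

/-- A continuous family of continuous functions on a compact space that depends holomorphically
on the parameter at every point is analytic as a map into the Banach space of continuous
functions. -/
theorem analyticOnNhd_of_continuousOn_of_eval {K : Type*} [TopologicalSpace K] [CompactSpace K]
    {Ψ : ℂ → C(K, ℂ)} {N : Set ℂ} (hN : IsOpen N) (hc : ContinuousOn Ψ N)
    (hd : ∀ z, DifferentiableOn ℂ (fun r => Ψ r z) N) : AnalyticOnNhd ℂ Ψ N := by
  intro c hcN
  obtain ⟨R, hR, hRN⟩ := Metric.nhds_basis_closedBall.mem_iff.1 (hN.mem_nhds hcN)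
  lift R to ℝ≥0 using hR.le
  have hci : CircleIntegrable Ψ c R :=
    (hc.mono (Metric.sphere_subset_closedBall.trans hRN)).circleIntegrable R.2
  -- The Cauchy integral of a merely continuous function is analytic; the scalar Cauchy formula at
  -- each `z` identifies it with `Ψ`.
  have hG := (hasFPowerSeriesOn_cauchy_integral hci (by exact_mod_cast hR)).analyticAt
  refine hG.congr ?_
  filter_upwards [Metric.ball_mem_nhds c hR] with w hw
  ext z
  let L : C(K, ℂ) →L[ℂ] ℂ := ContinuousMap.evalCLM ℂ z
  have h1 := Complex.two_pi_I_inv_smul_circleIntegral_sub_inv_smul_of_differentiable_on_off_countable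
    (f := fun r => Ψ r z) Set.countable_empty hw ((hd z).continuousOn.mono hRN) (fun x hx =>
      (hd z).differentiableAt (hN.mem_nhds (hRN (Metric.ball_subset_closedBall hx.1))))
  rw [← h1]
  refine (map_smul L _ _).trans (congrArg _ ?_)
  have hne : ∀ θ, circleMap c R θ - w ≠ 0 := fun θ h => by
    have h2 : circleMap c R θ ∈ Metric.sphere c R := circleMap_mem_sphere c R.2 θ
    rw [sub_eq_zero.1 h, Metric.mem_sphere] at h2
    exact (Metric.mem_ball.1 hw).ne h2
  have hcont : Continuous fun θ => Ψ (circleMap c R θ) :=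
    hc.comp_continuous (continuous_circleMap c R) fun θ =>
      hRN (Metric.sphere_subset_closedBall (circleMap_mem_sphere c R.2 θ))
  have hint : Continuous fun θ => deriv (circleMap c R) θ •
      ((circleMap c R θ - w)⁻¹ • Ψ (circleMap c R θ)) := by
    have h3 : Continuous (deriv (circleMap c R)) := by
      rw [show deriv (circleMap c R) = _ from funext (deriv_circleMap c R)]
      exact (continuous_circleMap 0 R).mul continuous_const
    exact h3.smul ((((continuous_circleMap c R).sub continuous_const).inv₀ hne).smul hcont)
  rw [circleIntegral, circleIntegral,
    ← ContinuousLinearMap.intervalIntegral_comp_comm L (hint.intervalIntegrable _ _)]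
  simp [L]

/-- Near the origin, a holomorphic function is a uniform limit of polynomials. -/
theorem exists_polynomial_near_of_mem_ball {F : ℂ → ℂ} (hF : AnalyticAt ℂ F 0) :
    ∃ ρ > 0, ∀ ε > 0, ∃ p : Polynomial ℂ, ∀ z, ‖z‖ < ρ → ‖F z - p.eval z‖ < ε := by
  obtain ⟨q, R, hq⟩ := hF
  obtain ⟨ρ, hρ0, hρ⟩ := ENNReal.lt_iff_exists_nnreal_btwn.1 hq.r_pos
  refine ⟨ρ, by exact_mod_cast hρ0, fun ε hε => ?_⟩
  obtain ⟨n, hn⟩ := (Metric.tendstoUniformlyOn_iff.1 (hq.tendstoUniformlyOn hρ) ε hε).exists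
  refine ⟨∑ k ∈ Finset.range n, Polynomial.monomial k (q.coeff k), fun z hz => ?_⟩
  have h := hn z (by simpa using hz)
  rw [dist_eq_norm, zero_add] at h
  have he : (∑ k ∈ Finset.range n, Polynomial.monomial k (q.coeff k)).eval z =
      q.partialSum n z := by
    simp only [FormalMultilinearSeries.partialSum, Polynomial.eval_finsetSum,
      FormalMultilinearSeries.apply_eq_pow_smul_coeff, Polynomial.eval_monomial, smul_eq_mul,
      mul_comm]
  rwa [he]

/-- Runge's theorem for star-shaped domains. -/
theorem exists_polynomial_near_of_starConvex {U : Set ℂ} (hU : IsOpen U)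
    (hstar : ∀ z ∈ U, ∀ s ∈ Set.Icc (0 : ℝ) 1, (s : ℂ) * z ∈ U) {F : ℂ → ℂ}
    (hF : DifferentiableOn ℂ F U) {K : Set ℂ} (hK : IsCompact K) (hKU : K ⊆ U) {ε : ℝ}
    (hε : 0 < ε) : ∃ p : Polynomial ℂ, ∀ z ∈ K, ‖F z - p.eval z‖ < ε := by
  classical
  rcases K.eq_empty_or_nonempty with rfl | ⟨k₀, hk₀⟩
  · exact ⟨0, by simp⟩
  have h0U : (0 : ℂ) ∈ U := by simpa using hstar k₀ (hKU hk₀) 0 (by simp)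
  have : CompactSpace K := isCompact_iff_compactSpace.1 hK
  -- The dilates `F (r * z)` form an analytic curve in `C(K, ℂ)`. Modulo the closure of the
  -- polynomials it vanishes near `r = 0`, hence up to `r = 1` by the identity theorem along `[0,
  -- 1]`.
  let N : Set ℂ := {r | ∀ z ∈ K, r * z ∈ U}
  have hN : IsOpen N := isOpen_iff_mem_nhds.2 fun r hr =>
    hK.eventually_forall_of_forall_eventually fun z hz =>
      (continuous_mul.tendsto (r, z)).eventually (hU.mem_nhds (hr z hz))
  have hcont : Continuous fun q : N × K => F (q.1 * q.2) :=
    hF.continuousOn.comp_continuous (by fun_prop) fun q => q.1.2 q.2 q.2.2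
  let Ψ : ℂ → C(K, ℂ) := fun r => if h : r ∈ N then ContinuousMap.curry ⟨_, hcont⟩ ⟨r, h⟩ else 0
  have hΨ : ∀ r ∈ N, ∀ z : K, Ψ r z = F (r * z) := fun r hr z => by simp [Ψ, hr]
  have hΨc : ContinuousOn Ψ N := by
    rw [continuousOn_iff_continuous_domRestrict]
    have : N.domRestrict Ψ = ContinuousMap.curry ⟨_, hcont⟩ := by
      ext r z
      exact hΨ r r.2 z
    rw [this]
    exact ContinuousMap.continuous _
  have hΨa : AnalyticOnNhd ℂ Ψ N := by
    refine analyticOnNhd_of_continuousOn_of_eval hN hΨc fun z => ?_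
    refine DifferentiableOn.congr (f := fun r => F (r * z)) ?_ fun r hr => hΨ r hr z
    exact hF.comp (by fun_prop) fun r hr => hr z z.2
  let P : Submodule ℂ C(K, ℂ) := (Subalgebra.toSubmodule (polynomialFunctions K)).topologicalClosure
  have hPc : IsClosed (P : Set C(K, ℂ)) := Submodule.isClosed_topologicalClosure _
  have hmem : ∀ g : C(K, ℂ), g ∈ P ↔
      ∀ ε > 0, ∃ p : Polynomial ℂ, ∀ z : K, ‖g z - p.eval (z : ℂ)‖ < ε := by
    intro g
    have : g ∈ P ↔ g ∈ closure (Set.range (Polynomial.toContinuousMapOnAlgHom (R := ℂ) K)) := by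
      rw [← polynomialFunctions_coe]
      exact Iff.rfl
    rw [this, Metric.mem_closure_range_iff]
    refine forall₂_congr fun ε hε => exists_congr fun p => ?_
    rw [ContinuousMap.dist_lt_iff hε]
    simp [dist_eq_norm]
  let Q : C(K, ℂ) →L[ℂ] C(K, ℂ) ⧸ P :=
    ⟨P.mkQ, continuous_quot_mk⟩
  have hQ : ∀ g, Q g = 0 ↔ g ∈ P := fun g => Submodule.Quotient.mk_eq_zero P
  let I : Set ℂ := (fun s : ℝ => (s : ℂ)) '' Set.Icc 0 1
  have hI : IsPreconnected I :=
    isPreconnected_Icc.image _ Complex.continuous_ofReal.continuousOn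
  have hIN : I ⊆ N := by
    rintro _ ⟨s, hs, rfl⟩ z hz
    exact hstar z (hKU hz) s hs
  -- For small `r`, `r * K` lies in a disc where Taylor polynomials of `F` converge uniformly.
  have hnear : ∀ᶠ r in 𝓝 (0 : ℂ), Q (Ψ r) = 0 := by
    obtain ⟨ρ, hρ, hpol⟩ := exists_polynomial_near_of_mem_ball (hF.analyticAt (hU.mem_nhds h0U))
    have h1 : ∀ᶠ r in 𝓝 (0 : ℂ), ∀ z ∈ K, ‖r * z‖ < ρ :=
      hK.eventually_forall_of_forall_eventually fun z hz => by
        have : Tendsto (fun q : ℂ × ℂ => ‖q.1 * q.2‖) (𝓝 (0, z)) (𝓝 0) := by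
          simpa using ((continuous_mul (M := ℂ)).norm.tendsto (0, z))
        exact this.eventually (gt_mem_nhds hρ)
    have h2 : ∀ᶠ r in 𝓝 (0 : ℂ), r ∈ N := hN.mem_nhds (hIN ⟨0, by simp⟩)
    filter_upwards [h1, h2] with r hr hrN
    rw [hQ, hmem]
    intro ε hε
    obtain ⟨p, hp⟩ := hpol ε hε
    refine ⟨p.comp (Polynomial.C r * Polynomial.X), fun z => ?_⟩
    rw [hΨ r hrN]
    simpa using hp _ (hr z z.2)
  have h1 : Q (Ψ 1) = 0 :=
    AnalyticOnNhd.eqOn_zero_of_preconnected_of_eventuallyEq_zero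
      (Q.comp_analyticOnNhd (hΨa.mono hIN)) hI (z₀ := 0) ⟨0, by simp⟩ hnear ⟨1, by simp⟩
  obtain ⟨p, hp⟩ := (hmem _).1 ((hQ _).1 h1) ε hε
  refine ⟨p, fun z hz => ?_⟩
  have := hp ⟨z, hz⟩
  rw [hΨ 1 (hIN ⟨1, by simp⟩)] at this
  simpa using this

/-- A real analytic function extends locally to a holomorphic function. -/
theorem exists_complex_extension_ball {f : ℝ → ℂ} {x : ℝ} (hf : AnalyticAt ℝ f x) :
    ∃ r > 0, ∃ G : ℂ → ℂ, DifferentiableOn ℂ G (Metric.ball (x : ℂ) r) ∧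
      ∀ y : ℝ, (y : ℂ) ∈ Metric.ball (x : ℂ) r → G y = f y := by
  obtain ⟨p, R, hp⟩ := hf
  -- The same Taylor coefficients, now with a complex variable.
  let q : FormalMultilinearSeries ℂ ℂ ℂ := FormalMultilinearSeries.ofScalars ℂ p.coeff
  have hrad : p.radius ≤ q.radius := FormalMultilinearSeries.radius_le_of_le fun n => by
    rw [FormalMultilinearSeries.ofScalars_norm, FormalMultilinearSeries.norm_apply_eq_norm_coef]
  obtain ⟨r, hr0, hr⟩ := ENNReal.lt_iff_exists_nnreal_btwn.1 hp.r_pos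
  have hq := (q.hasFPowerSeriesOnBall (hp.r_pos.trans_le (hp.r_le.trans hrad))).comp_sub (x : ℂ)
  rw [zero_add] at hq
  have hrq : (r : ENNReal) ≤ q.radius := hr.le.trans (hp.r_le.trans hrad)
  refine ⟨r, by exact_mod_cast hr0, fun z => q.sum (z - x), ?_, fun y hy => ?_⟩
  · refine hq.differentiableOn.mono ?_
    rw [← Metric.eball_coe]
    exact Metric.eball_subset_eball hrq
  · have hy' : ((y - x : ℝ) : ℂ) ∈ Metric.eball (0 : ℂ) r := by
      rw [Metric.eball_coe]
      simpa [dist_eq_norm] using hy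
    have hy'' : y - x ∈ Metric.eball (0 : ℝ) R := by
      refine Metric.eball_subset_eball hr.le ?_
      rw [Metric.eball_coe] at hy' ⊢
      simpa only [mem_ball_zero_iff, Complex.norm_real] using hy'
    have h1 := hp.hasSum hy''
    have h2 := (q.hasFPowerSeriesOnBall (hp.r_pos.trans_le (hp.r_le.trans hrad))).hasSum
      (Metric.eball_subset_eball hrq hy')
    have h3 : ∀ n, (q n fun _ => ((y - x : ℝ) : ℂ)) = p n fun _ => y - x := fun n => by
      rw [FormalMultilinearSeries.ofScalars_apply_eq,
        FormalMultilinearSeries.apply_eq_pow_smul_coeff, smul_eq_mul, Complex.real_smul, mul_comm]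
      push_cast
      rfl
    simp only [h3] at h2
    have h4 := h2.unique h1
    simpa using h4

/-- A real analytic function on `ℝ` extends to a holomorphic function on a complex neighbourhood
of `ℝ`. -/
theorem exists_complex_extension {f : ℝ → ℂ} (hf : AnalyticOnNhd ℝ f Set.univ) :
    ∃ W : Set ℂ, IsOpen W ∧ (∀ x : ℝ, (x : ℂ) ∈ W) ∧ ∃ F : ℂ → ℂ, DifferentiableOn ℂ F W ∧
      ∀ x : ℝ, F x = f x := by
  choose r hr G hG hGf using fun x : ℝ => exists_complex_extension_ball (hf x (Set.mem_univ x))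
  let B : ℝ → Set ℂ := fun x => Metric.ball (x : ℂ) (r x)
  have hglue : ∀ x y : ℝ, ∀ z ∈ B x, z ∈ B y → G x z = G y z := by
    intro x y z hzx hzy
    -- The discs have real centres, so overlapping ones meet on `ℝ`, where both extensions equal
    -- `f`; the identity theorem applies.
    have hre : ∀ u : ℝ, z ∈ B u → ((z.re : ℝ) : ℂ) ∈ B u := fun u hu => by
      refine Metric.mem_ball.2 (lt_of_le_of_lt ?_ (Metric.mem_ball.1 hu))
      rw [dist_eq_norm, dist_eq_norm, ← Complex.ofReal_sub, Complex.norm_real]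
      simpa using Complex.abs_re_le_norm (z - u)
    have hconn : IsPreconnected (B x ∩ B y) :=
      ((convex_ball _ _).inter (convex_ball _ _)).isPreconnected
    have hopen : IsOpen (B x ∩ B y) := Metric.isOpen_ball.inter Metric.isOpen_ball
    refine AnalyticOnNhd.eqOn_of_preconnected_of_frequently_eq
      (((hG x).mono Set.inter_subset_left).analyticOnNhd hopen)
      (((hG y).mono Set.inter_subset_right).analyticOnNhd hopen) hconn
      (z₀ := (z.re : ℂ)) ⟨hre x hzx, hre y hzy⟩ ?_ ⟨hzx, hzy⟩
    have ht : Tendsto (fun t : ℝ => (t : ℂ)) (𝓝[≠] z.re) (𝓝[≠] (z.re : ℂ)) :=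
      Complex.continuous_ofReal.continuousAt.continuousWithinAt.tendsto_nhdsWithin
        fun t ht => by simpa using ht
    refine ht.frequently (Eventually.frequently ?_)
    have hnh : ∀ᶠ t : ℝ in 𝓝 z.re, (t : ℂ) ∈ B x ∩ B y :=
      Complex.continuous_ofReal.continuousAt.eventually (hopen.mem_nhds ⟨hre x hzx, hre y hzy⟩)
    filter_upwards [hnh.filter_mono nhdsWithin_le_nhds] with t htB
    rw [hGf x t htB.1, hGf y t htB.2]
  have hW : ∀ z ∈ ⋃ x, B x, ∃ x, z ∈ B x := fun z hz => Set.mem_iUnion.1 hz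
  classical
  let F : ℂ → ℂ := fun z => if h : ∃ x, z ∈ B x then G h.choose z else 0
  have hF : ∀ x, ∀ z ∈ B x, F z = G x z := fun x z hz => by
    have h : ∃ x, z ∈ B x := ⟨x, hz⟩
    simp only [F, dif_pos h]
    exact hglue _ _ z h.choose_spec hz
  refine ⟨⋃ x, B x, isOpen_iUnion fun _ => Metric.isOpen_ball,
    fun x => Set.mem_iUnion.2 ⟨x, Metric.mem_ball_self (hr x)⟩, F, fun z hz => ?_, fun x => ?_⟩
  · obtain ⟨x, hx⟩ := Set.mem_iUnion.1 hz
    have hB : B x ∈ 𝓝 z := Metric.isOpen_ball.mem_nhds hx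
    exact (((hG x).differentiableAt hB).congr_of_eventuallyEq
      (eventually_of_mem hB (hF x))).differentiableWithinAt
  · rw [hF x x (Metric.mem_ball_self (hr x)), hGf x x (Metric.mem_ball_self (hr x))]

/-! ### Density of the polynomials -/

namespace RealAnalyticSpace

/-- A polynomial as an element of `H(U)`. -/
def polynomial (U : Opens ℂ) (p : Polynomial ℂ) : HolomorphicSpace U :=
  ⟨⟨fun z => p.eval (z : ℂ), by fun_prop⟩, fun z => p.eval z, p.differentiable.differentiableOn,
    fun _ => rfl⟩

theorem restrict_polynomial_mem_span (U : Opens ℂ) (hU : ContainsReals U) (p : Polynomial ℂ) :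
    restrict U hU (polynomial U p) ∈ Submodule.span ℂ (Set.range monomial) := by
  have h : restrict U hU (polynomial U p) =
      ∑ k ∈ Finset.range (p.natDegree + 1), p.coeff k • monomial k := by
    let e : RealAnalyticSpace →ₗ[ℂ] ℝ → ℂ := realAnalyticSubmodule.subtype
    have he : Function.Injective e := Subtype.val_injective
    apply he
    rw [map_sum e]
    ext x
    rw [Finset.sum_apply]
    exact p.eval_eq_sum_range (x : ℂ)
  rw [h]
  exact Submodule.sum_mem _ fun k _ => Submodule.smul_mem _ _ (Submodule.subset_span ⟨k, rfl⟩)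

/-- The polynomials are dense in `𝒜(ℝ)`. -/
theorem dense_span_monomial :
    Dense (Submodule.span ℂ (Set.range monomial) : Set RealAnalyticSpace) := by
  intro f
  obtain ⟨W, hW, hRW, F, hF, hFf⟩ := exists_complex_extension f.2
  -- The points whose segment to `0` stays in `W`: star-shaped, and still containing `ℝ`.
  let V : Set ℂ := {z | ∀ s ∈ Set.Icc (0 : ℝ) 1, (s : ℂ) * z ∈ W}
  have hV : IsOpen V := isOpen_iff_mem_nhds.2 fun z hz =>
    isCompact_Icc.eventually_forall_of_forall_eventually fun s hs => by
      have : Continuous fun q : ℂ × ℝ => (q.2 : ℂ) * q.1 := by fun_prop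
      exact (this.tendsto (z, s)).eventually (hW.mem_nhds (hz s hs))
  have hVW : V ⊆ W := fun z hz => by simpa using hz 1 (by simp)
  have hstar : ∀ z ∈ V, ∀ s ∈ Set.Icc (0 : ℝ) 1, (s : ℂ) * z ∈ V := by
    intro z hz s hs t ht
    rw [← mul_assoc, ← Complex.ofReal_mul]
    exact hz _ ⟨mul_nonneg ht.1 hs.1, mul_le_one₀ ht.2 hs.1 hs.2⟩
  let U : Opens ℂ := ⟨V, hV⟩
  have hU : ContainsReals U := fun x s _ => by
    rw [← Complex.ofReal_mul]
    exact hRW _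
  have hFV : DifferentiableOn ℂ F V := hF.mono hVW
  let g : HolomorphicSpace U :=
    ⟨⟨fun z => F z, hFV.continuousOn.comp_continuous continuous_subtype_val fun z => z.2⟩,
      F, hFV, fun _ => rfl⟩
  have hg : restrict U hU g = f := Subtype.ext (funext hFf)
  rw [← hg]
  refine map_mem_closure (continuous_restrict U hU) (s := Set.range (polynomial U)) ?_ ?_
  · rw [closure_subtype, mem_closure_iff_nhds_basis
      (nhds_basis_uniformity' Metric.uniformity_basis_dist.compactConvergenceUniformity)]
    rintro ⟨K, ε⟩ ⟨hK, hε⟩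
    obtain ⟨p, hp⟩ := exists_polynomial_near_of_starConvex hV hstar hFV
      (hK.image continuous_subtype_val) (by rintro _ ⟨z, _, rfl⟩; exact z.2) hε
    refine ⟨_, ⟨_, ⟨p, rfl⟩, rfl⟩, fun z hz => ?_⟩
    have := hp z ⟨z, hz, rfl⟩
    rwa [← dist_eq_norm] at this
  · rintro _ ⟨p, rfl⟩
    exact restrict_polynomial_mem_span U hU p

end RealAnalyticSpace

end

/-! ### Orbits of eigenvectors and products of semigroups -/

noncomputable section

section Semigroups

variable {X : Type*} [AddCommGroup X] [Module ℂ X] [TopologicalSpace X]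

theorem Generates.tendsto {M : X →L[ℂ] X} {T : ℝ≥0 → X →L[ℂ] X} (h : Generates M T) (x : X) :
    Tendsto (fun t : ℝ≥0 => (((t : ℝ) : ℂ))⁻¹ • (T t x - x)) (𝓝[>] 0) (𝓝 (M x)) := by
  have : (x, M x) ∈ generatorGraph T := by rw [h.2]; rfl
  exact this

theorem generatorGraph_eq_of_tendsto [T2Space X] {M : X →L[ℂ] X} {T : ℝ≥0 → X →L[ℂ] X}
    (h : ∀ x, Tendsto (fun t : ℝ≥0 => (((t : ℝ) : ℂ))⁻¹ • (T t x - x)) (𝓝[>] 0) (𝓝 (M x))) :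
    generatorGraph T = {p | p.2 = M p.1} := by
  ext ⟨x, y⟩
  refine ⟨fun hp => tendsto_nhds_unique hp (h x), fun hp => ?_⟩
  have hy : y = M x := hp
  rw [hy]
  exact h x

/-- The orbits of a `C₀`-semigroup at eigenvectors of its generator are exponentials, when tested
with a continuous functional. -/
theorem Generates.map_apply_of_eigenvector [IsTopologicalAddGroup X] [ContinuousSMul ℂ X]
    {M : X →L[ℂ] X} {T : ℝ≥0 → X →L[ℂ] X} (h : Generates M T)
    {x : X} {a : ℂ} (hx : M x = a • x) (L : X →L[ℂ] ℂ) (t : ℝ≥0) :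
    L (T t x) = Complex.exp (a * t) * L x := by
  let u : ℝ → ℂ := fun s => L (T s.toNNReal x)
  have hu : Continuous u :=
    L.continuous.comp ((h.1.strongly_continuous x).comp continuous_real_toNNReal)
  -- The generator gives only right derivatives; with continuity these suffice for `exp (-(a * s)) *
  -- u s` to be constant.
  have hder : ∀ s : ℝ, 0 ≤ s → HasDerivWithinAt u (a * u s) (Set.Ici s) s := by
    intro s hs
    rw [← hasDerivWithinAt_Ioi_iff_Ici, hasDerivWithinAt_iff_tendsto_slope' (by simp)]
    have hlim : Tendsto (fun r : ℝ => (r - s).toNNReal) (𝓝[>] s) (𝓝[>] 0) := by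
      refine tendsto_nhdsWithin_iff.2 ⟨?_, ?_⟩
      · refine (Continuous.tendsto' (by fun_prop) s 0 (by simp)).mono_left nhdsWithin_le_nhds
      · filter_upwards [self_mem_nhdsWithin] with r hr
        exact Real.toNNReal_pos.2 (sub_pos.2 hr)
    have h1 := ((L.continuous.comp (T s.toNNReal).continuous).tendsto _).comp
      ((h.tendsto x).comp hlim)
    have h2 : (L ∘ T s.toNNReal) (M x) = a * u s := by simp [hx, u]
    rw [h2] at h1
    refine h1.congr' ?_
    filter_upwards [self_mem_nhdsWithin] with r hr
    have hrs : 0 < r - s := sub_pos.2 hr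
    have h3 : T r.toNNReal x = T s.toNNReal (T (r - s).toNNReal x) := by
      have : r.toNNReal = s.toNNReal + (r - s).toNNReal := by
        rw [← Real.toNNReal_add hs hrs.le]
        congr 1
        ring
      rw [this, h.1.map_add]
      rfl
    simp only [Function.comp_apply, slope, vsub_eq_sub, u, h3, map_smul, map_sub,
      Real.coe_toNNReal _ hrs.le, Complex.real_smul, smul_eq_mul, Complex.ofReal_inv]
  let v : ℝ → ℂ := fun s => Complex.exp (-(a * s)) * u s
  have hv : Continuous v := by
    have : Continuous fun s : ℝ => Complex.exp (-(a * s)) := by fun_prop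
    exact this.mul hu
  have hvd : ∀ s ∈ Set.Ico (0 : ℝ) t, HasDerivWithinAt v 0 (Set.Ici s) s := by
    intro s hs
    have h1 : HasDerivAt (fun s : ℝ => Complex.exp (-(a * s))) (Complex.exp (-(a * s)) * -a) s := by
      have h2 : HasDerivAt (fun s : ℝ => a * (s : ℂ)) a s := by
        simpa using (Complex.ofRealCLM.hasDerivAt (x := s)).const_mul a
      exact h2.neg.cexp
    refine (h1.hasDerivWithinAt.mul (hder s hs.1)).congr_deriv ?_
    ring
  have hc := constant_of_has_deriv_right_zero hv.continuousOn hvd t ⟨t.2, le_rfl⟩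
  simp only [v, u, Real.toNNReal_coe, Complex.ofReal_zero, mul_zero, neg_zero, Complex.exp_zero,
    Real.toNNReal_zero, h.1.map_zero, one_mul, ContinuousLinearMap.id_apply] at hc
  rw [← hc, ← mul_assoc, ← Complex.exp_add]
  simp

/-- The product of two commuting `C₀`-semigroups on a barrelled space is a `C₀`-semigroup, generated
by the sum of the generators. -/
theorem Generates.comp_of_commute [IsTopologicalAddGroup X] [ContinuousSMul ℂ X] [T2Space X]
    [PolynormableSpace ℂ X] [BarrelledSpace ℂ X] {A B : X →L[ℂ] X} {S T : ℝ≥0 → X →L[ℂ] X}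
    (hS : Generates A S) (hT : Generates B T) (hcomm : ∀ s t, S s ∘L T t = T t ∘L S s) :
    Generates (A + B) (fun t => S t ∘L T t) := by
  have hjoint : ∀ (l : Filter ℝ≥0) (c : ℝ≥0) (g : ℝ≥0 → X) (x : X), l ≤ 𝓝 c →
      Tendsto g l (𝓝 x) → Tendsto (fun t => S t (g t)) l (𝓝 (S c x)) := by
    intro l c g x hl hg
    -- Orbits over a compact interval are compact, hence bounded; `c + 1` makes the interval a
    -- neighbourhood of `c` in `ℝ≥0`.
    have hb : ∀ x, Bornology.IsVonNBounded ℂ (Set.range fun t : Set.Icc 0 (c + 1) => S t x) := by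
      intro x
      refine IsCompact.isVonNBounded ℂ (isCompact_range ?_)
      exact (hS.1.strongly_continuous x).comp continuous_subtype_val
    have hmem : ∀ᶠ t in l, t ∈ Set.Icc 0 (c + 1) := by
      refine Eventually.filter_mono hl ?_
      filter_upwards [Iic_mem_nhds (lt_add_one c)] with t ht using ⟨zero_le, ht⟩
    let i : ℝ≥0 → Set.Icc 0 (c + 1) := Set.projIcc 0 (c + 1) zero_le
    have hi : ∀ᶠ t in l, (i t : ℝ≥0) = t := by
      filter_upwards [hmem] with t ht
      simp only [i, Set.projIcc_of_mem _ ht]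
    have hy : Tendsto (fun t => S (i t) x) l (𝓝 (S c x)) := by
      refine (((hS.1.strongly_continuous x).tendsto c).mono_left hl).congr' ?_
      filter_upwards [hi] with t ht
      rw [ht]
    refine (tendsto_apply_of_isVonNBounded hb (i := i) hg hy).congr' ?_
    filter_upwards [hi] with t ht
    rw [ht]
  refine ⟨⟨fun t s => ?_, ?_, fun x => ?_⟩, generatorGraph_eq_of_tendsto fun x => ?_⟩
  · rw [hS.1.map_add, hT.1.map_add]
    ext x
    have := DFunLike.congr_fun (hcomm s t) (T s x)
    simp only [ContinuousLinearMap.comp_apply] at this ⊢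
    rw [this]
  · rw [hS.1.map_zero, hT.1.map_zero]
    rfl
  · exact continuous_iff_continuousAt.2 fun c =>
      hjoint (𝓝 c) c _ _ le_rfl ((hT.1.strongly_continuous x).tendsto c)
  -- Uses `(S t (T t x) - x) / t = (S t x - x) / t + S t ((T t x - x) / t)`.
  · have h1 := hjoint (𝓝[>] 0) 0 _ _ nhdsWithin_le_nhds (hT.tendsto x)
    rw [hS.1.map_zero] at h1
    have h2 := (hS.tendsto x).add h1
    refine h2.congr fun t => ?_
    simp only [map_smul, map_sub, ContinuousLinearMap.comp_apply, ← smul_add]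
    congr 1
    abel

end Semigroups

/-! ### Semigroups generated by multipliers -/

namespace RealAnalyticSpace

/-- Evaluation at a point as a continuous functional. -/
def evalCLM (x : ℝ) : RealAnalyticSpace →L[ℂ] ℂ where
  toFun f := f x
  map_add' _ _ := rfl
  map_smul' _ _ := rfl
  cont := continuous_eval x

theorem ext_evalCLM {f g : RealAnalyticSpace} (h : ∀ x, evalCLM x f = evalCLM x g) : f = g :=
  Subtype.ext (funext h)

/-- Continuous operators on `𝒜(ℝ)` that agree on the monomials are equal. -/
theorem ext_monomial {S T : RealAnalyticSpace →L[ℂ] RealAnalyticSpace}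
    (h : ∀ n, S (monomial n) = T (monomial n)) : S = T :=
  ContinuousLinearMap.ext_on dense_span_monomial (by rintro _ ⟨n, rfl⟩; exact h n)

theorem apply_monomial_of_generates {A : RealAnalyticSpace →L[ℂ] RealAnalyticSpace}
    {T : ℝ≥0 → RealAnalyticSpace →L[ℂ] RealAnalyticSpace} (h : Generates A T) {n : ℕ} {a : ℂ}
    (ha : A (monomial n) = a • monomial n) (t : ℝ≥0) :
    T t (monomial n) = Complex.exp (a * t) • monomial n :=
  ext_evalCLM fun x => by
    rw [h.map_apply_of_eigenvector ha, map_smul, smul_eq_mul]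

theorem IsMultiplier.add {A B : RealAnalyticSpace →L[ℂ] RealAnalyticSpace} (hA : IsMultiplier A)
    (hB : IsMultiplier B) : IsMultiplier (A + B) := by
  obtain ⟨a, ha⟩ := hA
  obtain ⟨b, hb⟩ := hB
  refine ⟨a + b, fun n => ?_⟩
  rw [add_apply, ha, hb, Pi.add_apply, add_smul]

/-- Semigroups generated by multipliers commute. -/
theorem IsMultiplier.comp_comm {A B : RealAnalyticSpace →L[ℂ] RealAnalyticSpace}
    {S T : ℝ≥0 → RealAnalyticSpace →L[ℂ] RealAnalyticSpace} (hA : IsMultiplier A)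
    (hB : IsMultiplier B) (hS : Generates A S) (hT : Generates B T) (s t : ℝ≥0) :
    S s ∘L T t = T t ∘L S s := by
  obtain ⟨a, ha⟩ := hA
  obtain ⟨b, hb⟩ := hB
  refine ext_monomial fun n => ?_
  simp only [ContinuousLinearMap.comp_apply, apply_monomial_of_generates hS (ha n),
    apply_monomial_of_generates hT (hb n), map_smul]
  exact smul_comm _ _ _

/-- A multiplier generates at most one semigroup. -/
theorem IsMultiplier.unique {A : RealAnalyticSpace →L[ℂ] RealAnalyticSpace}
    {S T : ℝ≥0 → RealAnalyticSpace →L[ℂ] RealAnalyticSpace} (hA : IsMultiplier A)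
    (hS : Generates A S) (hT : Generates A T) : S = T := by
  obtain ⟨a, ha⟩ := hA
  refine funext fun t => ext_monomial fun n => ?_
  rw [apply_monomial_of_generates hS (ha n), apply_monomial_of_generates hT (ha n)]

end RealAnalyticSpace

end
theorem mainTheorem6 :
    (∀ A ∈ generatingMultipliers, ∀ B ∈ generatingMultipliers, A + B ∈ generatingMultipliers) ∧
    (∀ (A B : RealAnalyticSpace →L[ℂ] RealAnalyticSpace)
      (TA TB : ℝ≥0 → RealAnalyticSpace →L[ℂ] RealAnalyticSpace),
      RealAnalyticSpace.IsMultiplier A → RealAnalyticSpace.IsMultiplier B →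
      Generates A TA → Generates B TB →
      Generates (A + B) (fun t => TA t ∘L TB t) ∧
      ∀ S : ℝ≥0 → RealAnalyticSpace →L[ℂ] RealAnalyticSpace,
        Generates (A + B) S → ∀ t, S t = TA t ∘L TB t) := by
  have h : ∀ (A B : RealAnalyticSpace →L[ℂ] RealAnalyticSpace)
      (TA TB : ℝ≥0 → RealAnalyticSpace →L[ℂ] RealAnalyticSpace),
      RealAnalyticSpace.IsMultiplier A → RealAnalyticSpace.IsMultiplier B →
      Generates A TA → Generates B TB → Generates (A + B) (fun t => TA t ∘L TB t) :=
    fun A B TA TB hA hB hTA hTB => hTA.comp_of_commute hTB (hA.comp_comm hB hTA hTB)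
  refine ⟨?_, fun A B TA TB hA hB hTA hTB => ⟨h A B TA TB hA hB hTA hTB, fun S hS t => ?_⟩⟩
  · rintro A ⟨hA, TA, hTA⟩ B ⟨hB, TB, hTB⟩
    exact ⟨hA.add hB, _, h A B TA TB hA hB hTA hTB⟩
  · rw [(hA.add hB).unique hS (h A B TA TB hA hB hTA hTB)]
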